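/- For $1\le d<\infty$ let $\mathbb B_d$ be the open Euclidean unit ball of $\mathbb C^d$, let $$H^2_d=\Big\{F(z)=\sum_{\alpha\in\mathbb N_0^d}c_\alpha z^\alpha \text{ on } \mathbb B_d:\ \sum_{\alpha}|c_\alpha|^2\frac{\alpha!}{|\alpha|!}<\infty\Big\}$$ be the Drury–Arveson space, and let $\mathcal M_d=\{\varphi:\mathbb B_d\to\mathbb C:\ \varphi F\in H^2_d\text{ for all }F\in H^2_d\}$ be its multiplier algebra. A set $V\subset\mathbb B_d$ is called a variety if $V=\{z\in\mathbb B_d:\varphi(z)=0\text{ for all }\varphi\in E\}$ for some $E\subset\mathcal M_d$; put $\mathcal M_V=\{\varphi|_V:\varphi\in\mathcal M_d\}$. Let $\mathbb D$ be the open unit disc in $\mathbb C$ and $\mathbb T$ the unit circle. An analytic disc attached to the unit sphere is a variety $V\subset\mathbb B_d$ for which there is an injective analytic map $f:\mathbb D\to\mathbb B_d$, called an embedding map of $V$, such that $f'(z)\neq0$ for all $z\in\mathbb D$, $V=f(\mathbb D)$, $f$ extends to a $C^2$ map on $\overline{\mathbb D}$ (the extension is again denoted by $f$), and for $x\in\overline{\mathbb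 D}$ one has $\|f(x)\|=1$ if and only if $|x|=1$. For such $V$ and $f$ put $$\mathcal M_f=\{\varphi:\mathbb D\to\mathbb C:\ \varphi\circ f^{-1}\in\mathcal M_V\}.$$ **Theorem.** Let $V\subset\mathbb B_d$ and $W\subset\mathbb B_e$ ($1\le d,e<\infty$) be analytic discs attached to the unit sphere, with embedding maps $f$ and $g$ respectively. If $\mathcal M_f=\mathcal M_g$ (as algebras of functions on $\mathbb D$), then for all $\xi,\zeta\in\mathbb T$ $$f(\xi)=f(\zeta)\iff g(\xi)=g(\zeta),$$ that is, $f$ and $g$ have the same self-crossings on the boundary. -/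

import Mathlib

open Metric


/-- The open Euclidean unit ball `𝔹_d` of `ℂ^d`. -/
abbrev UnitBall (d : ℕ) : Type := ball (0 : EuclideanSpace ℂ (Fin d)) 1

/-- The open unit disc `𝔻` of `ℂ`. -/
abbrev Disc : Type := ball (0 : ℂ) 1

/-- The weight `α! / |α|!` of a multi-index `α`. -/
noncomputable def multiWeight {d : ℕ} (α : Fin d → ℕ) : ℝ :=
  ((∏ i, (α i).factorial : ℕ) : ℝ) / ((∑ i, α i).factorial : ℕ)

/-- `c` is a family of coefficients of finite Drury-Arveson norm whose power series
`∑ c_α z^α` sums to `F` on the ball. -/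
def IsDruryArvesonExpansion {d : ℕ} (F : UnitBall d → ℂ) (c : (Fin d → ℕ) → ℂ) : Prop :=
  Summable (fun α => ‖c α‖ ^ 2 * multiWeight α) ∧
    ∀ z : UnitBall d, HasSum (fun α => c α * ∏ i, (z : EuclideanSpace ℂ (Fin d)) i ^ α i) (F z)

/-- The Drury-Arveson space `H²_d`, as a vector space of functions on the ball. -/
def druryArveson (d : ℕ) : Submodule ℂ (UnitBall d → ℂ) where
  carrier := {F | ∃ c, IsDruryArvesonExpansion F c}
  zero_mem' := ⟨0, by simp [summable_zero], fun z => by simp [hasSum_zero]⟩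
  add_mem' := by
    rintro F G ⟨a, ha, ha'⟩ ⟨b, hb, hb'⟩
    refine ⟨a + b, ?_, fun z => ?_⟩
    · refine Summable.of_nonneg_of_le (fun α => ?_) (fun α => ?_)
        ((ha.mul_left 2).add (hb.mul_left 2))
      · unfold multiWeight; positivity
      · have hw : 0 ≤ multiWeight α := by unfold multiWeight; positivity
        have h1 : ‖(a + b) α‖ ≤ ‖a α‖ + ‖b α‖ := norm_add_le _ _
        have h2 : ‖(a + b) α‖ ^ 2 ≤ 2 * ‖a α‖ ^ 2 + 2 * ‖b α‖ ^ 2 := by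
          nlinarith [norm_nonneg ((a + b) α), sq_nonneg (‖a α‖ - ‖b α‖)]
        nlinarith [mul_le_mul_of_nonneg_right h2 hw]
    · simpa [add_mul] using (ha' z).add (hb' z)
  smul_mem' := by
    rintro r F ⟨a, ha, ha'⟩
    refine ⟨r • a, ?_, fun z => ?_⟩
    · simpa [mul_pow, mul_assoc] using ha.mul_left (‖r‖ ^ 2)
    · simpa [mul_assoc] using (ha' z).mul_left r

/-- The multiplier algebra `M_d = Mult(H²_d)`: the functions `φ` on the ball with
`φ F ∈ H²_d` for every `F ∈ H²_d`. -/
def multiplierAlgebra (d : ℕ) : Subalgebra ℂ (UnitBall d → ℂ) where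
  carrier := {φ | ∀ F ∈ druryArveson d, φ * F ∈ druryArveson d}
  mul_mem' := fun {φ ψ} hφ hψ F hF => by
    rw [mul_assoc]; exact hφ _ (hψ F hF)
  add_mem' := fun {φ ψ} hφ hψ F hF => by
    rw [add_mul]; exact add_mem (hφ F hF) (hψ F hF)
  algebraMap_mem' := fun r F hF => by
    rw [← Algebra.smul_def]; exact Submodule.smul_mem _ r hF

/-- A (multiplier) variety in the ball: a joint zero set of multipliers of `H²_d`. -/
def IsMultiplierVariety {d : ℕ} (V : Set (UnitBall d)) : Prop :=
  ∃ E : Set (UnitBall d → ℂ), E ⊆ multiplierAlgebra d ∧ V = {z | ∀ φ ∈ E, φ z = 0}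

/-- Composition with a map `u : X → Y` on the right, as a homomorphism of function algebras. -/
def precompAlgHom {X Y : Type*} (u : X → Y) : (Y → ℂ) →ₐ[ℂ] (X → ℂ) where
  toFun φ := φ ∘ u
  map_one' := rfl
  map_mul' _ _ := rfl
  map_zero' := rfl
  map_add' _ _ := rfl
  commutes' _ := rfl

/-- The algebra `M_V = {φ|_V : φ ∈ M_d}`. -/
def varietyAlgebra {d : ℕ} (V : Set (UnitBall d)) : Subalgebra ℂ (V → ℂ) :=
  (multiplierAlgebra d).map (precompAlgHom (Subtype.val : V → UnitBall d))

/-- `V ⊆ 𝔹_d` is an analytic disc attached to the unit sphere with embedding map `f`.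
Only the values of `f` on the closed unit disc matter: on the circle `f` is the (unique)
continuous extension of the map on the open disc. -/
structure IsAttachedDisc {d : ℕ} (V : Set (UnitBall d)) (f : ℂ → EuclideanSpace ℂ (Fin d)) :
    Prop where
  isVariety : IsMultiplierVariety V
  analytic : AnalyticOnNhd ℂ f (ball 0 1)
  mapsTo : Set.MapsTo f (ball 0 1) (ball 0 1)
  injOn : Set.InjOn f (ball 0 1)
  deriv_ne_zero : ∀ z ∈ ball (0 : ℂ) 1, deriv f z ≠ 0
  image_eq : f '' ball 0 1 = Subtype.val '' V
  contDiffOn : ContDiffOn ℝ 2 f (closedBall 0 1)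
  norm_eq_one_iff : ∀ z ∈ closedBall (0 : ℂ) 1, ‖f z‖ = 1 ↔ ‖z‖ = 1

namespace IsAttachedDisc

variable {d : ℕ} {V : Set (UnitBall d)} {f : ℂ → EuclideanSpace ℂ (Fin d)}

theorem mem_image (h : IsAttachedDisc V f) (z : Disc) : ⟨f z, h.mapsTo z.2⟩ ∈ V := by
  have h1 : f z ∈ Subtype.val '' V := h.image_eq ▸ Set.mem_image_of_mem f z.2
  obtain ⟨v, hv, hvz⟩ := h1
  have h2 : v = ⟨f z, h.mapsTo z.2⟩ := Subtype.ext hvz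
  exact h2 ▸ hv

/-- The embedding map as a map from `𝔻` to `V`. -/
def toV (h : IsAttachedDisc V f) (z : Disc) : V := ⟨⟨f z, h.mapsTo z.2⟩, h.mem_image z⟩

theorem toV_bijective (h : IsAttachedDisc V f) : Function.Bijective h.toV := by
  constructor
  · intro z w hzw
    exact Subtype.ext (h.injOn z.2 w.2 (congrArg (fun v : V => (v.1 : EuclideanSpace ℂ (Fin d))) hzw))
  · rintro ⟨v, hv⟩
    have h1 : (v : EuclideanSpace ℂ (Fin d)) ∈ f '' ball 0 1 := h.image_eq ▸ ⟨v, hv, rfl⟩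
    obtain ⟨z, hz, hzv⟩ := h1
    exact ⟨⟨z, hz⟩, Subtype.ext (Subtype.ext hzv)⟩

/-- The embedding map as a bijection from `𝔻` onto `V`. -/
noncomputable def equivV (h : IsAttachedDisc V f) : Disc ≃ V :=
  Equiv.ofBijective h.toV h.toV_bijective

/-- The pulled-back algebra `M_f = {φ : 𝔻 → ℂ | φ ∘ f⁻¹ ∈ M_V}`. -/
noncomputable def pullbackAlgebra (h : IsAttachedDisc V f) : Subalgebra ℂ (Disc → ℂ) :=
  (varietyAlgebra V).comap (precompAlgHom h.equivV.symm)

/-- Membership in `M_f`, spelled out: `φ = ψ ∘ f` on `𝔻` for a multiplier `ψ` of `H²_d`. -/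
theorem mem_pullbackAlgebra (h : IsAttachedDisc V f) (φ : Disc → ℂ) :
    φ ∈ h.pullbackAlgebra ↔
      ∃ ψ ∈ multiplierAlgebra d, ∀ z : Disc, φ z = ψ ⟨f z, h.mapsTo z.2⟩ := by
  constructor
  · rintro ⟨ψ, hψ, hψφ⟩
    refine ⟨ψ, hψ, fun z => ?_⟩
    have h1 := congrFun hψφ (h.equivV z)
    have h2 : ψ (h.equivV z).1 = φ (h.equivV.symm (h.equivV z)) := h1
    rw [Equiv.symm_apply_apply] at h2
    exact h2.symm
  · rintro ⟨ψ, hψ, hψφ⟩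
    refine ⟨ψ, hψ, funext fun v => ?_⟩
    obtain ⟨z, rfl⟩ := h.equivV.surjective v
    change ψ (h.equivV z).1 = φ (h.equivV.symm (h.equivV z))
    rw [Equiv.symm_apply_apply]
    exact (hψφ z).symm

end IsAttachedDisc

/-! Suppose `f ξ = f ζ = p`. The coordinates of `g` lie in `M_g = M_f`, so each is `ψ ∘ f` on the
disc with `ψ` a multiplier, hence `ψ ∈ H²_d`. It is enough that `ψ` has the same boundary behaviour
along two curves in `V` tending to `p`, one from each branch.

Since `F z - F w` is the pairing of `F` with a difference of kernel functions, a bound on the norm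
of that difference and density of polynomials give `F z - F w → 0` as both points tend to `p`
(`tendsto_sub_of_mem_druryArveson`). The kernel functions themselves blow up at `p`, so the two
speeds must be matched. The function `⟨f ξ, f ·⟩` maps the disc to itself and has a positive radial
derivative at `ξ` (`exists_pos_hasDerivWithinAt_radial`). Rescaling each radius by this derivative
gives curves `p - t v + O(t²)` and `p - t w + O(t²)` with `⟨p, v⟩ = ⟨p, w⟩ = 1`
(`exists_radial_expansion`). All four kernel values are then `1/(2t) + O(1)`, and the singular parts
cancel in the squared distance (`exists_daKernelDistSq_le`). -/

open Filter Topology ComplexConjugate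

/-! ### Power series expansion of the Drury–Arveson kernel -/

theorem multiWeight_pos {d : ℕ} (α : Fin d → ℕ) : 0 < multiWeight α := by
  unfold multiWeight
  have h1 : 0 < ∏ i, (α i).factorial := Finset.prod_pos fun i _ => Nat.factorial_pos _
  have h2 : 0 < (∑ i, α i).factorial := Nat.factorial_pos _
  positivity

theorem inv_multiWeight {d : ℕ} (α : Fin d → ℕ) :
    (multiWeight α)⁻¹ = Nat.multinomial Finset.univ α := by
  have h := Nat.multinomial_spec Finset.univ α
  have h1 : 0 < ∏ i, (α i).factorial := Finset.prod_pos fun i _ => Nat.factorial_pos _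
  unfold multiWeight
  rw [inv_div, div_eq_iff (by positivity), ← h]
  push_cast
  ring

/-- The monomial `z^α`. -/
def monomialAt {d : ℕ} (α : Fin d → ℕ) (z : Fin d → ℂ) : ℂ := ∏ i, z i ^ α i

theorem monomialAt_mul {d : ℕ} (α : Fin d → ℕ) (z w : Fin d → ℂ) :
    monomialAt α (z * w) = monomialAt α z * monomialAt α w := by
  simp [monomialAt, mul_pow, Finset.prod_mul_distrib]

theorem monomialAt_conj {d : ℕ} (α : Fin d → ℕ) (z : Fin d → ℂ) :
    monomialAt α (fun i => conj (z i)) = conj (monomialAt α z) := by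
  simp [monomialAt]

theorem continuous_monomialAt {d : ℕ} (α : Fin d → ℕ) :
    Continuous (fun z : EuclideanSpace ℂ (Fin d) => monomialAt α z) := by
  unfold monomialAt
  fun_prop

theorem sum_piAntidiag_monomialAt {d : ℕ} (x : Fin d → ℂ) (n : ℕ) :
    ∑ α ∈ Finset.piAntidiag Finset.univ n, (multiWeight α : ℂ)⁻¹ * monomialAt α x
      = (∑ i, x i) ^ n := by
  rw [Finset.sum_pow_eq_sum_piAntidiag]
  refine Finset.sum_congr rfl fun α _ => ?_
  rw [← Complex.ofReal_inv, inv_multiWeight]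
  simp [monomialAt]

theorem sum_piAntidiag_norm_monomialAt {d : ℕ} (x : Fin d → ℂ) (n : ℕ) :
    ∑ α ∈ Finset.piAntidiag Finset.univ n, ‖(multiWeight α : ℂ)⁻¹ * monomialAt α x‖
      = (∑ i, ‖x i‖) ^ n := by
  rw [Finset.sum_pow_eq_sum_piAntidiag]
  refine Finset.sum_congr rfl fun α _ => ?_
  rw [← Complex.ofReal_inv, inv_multiWeight]
  simp [monomialAt]

/-- Used to sum over multi-indices degree by degree. Summability is a separate hypothesis because
convergence of the grouped series does not imply it. -/
theorem hasSum_of_hasSum_fiber {β : Type*} {f : β → ℂ} (deg : β → ℕ) {s : ℕ → Finset β}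
    (hs : ∀ n b, b ∈ s n ↔ deg b = n) (hf : Summable f) {a : ℂ}
    (ha : HasSum (fun n => ∑ b ∈ s n, f b) a) : HasSum f a := by
  have h1 := hf.hasSum
  have h2 := ((Equiv.sigmaFiberEquiv deg).hasSum_iff.2 h1).sigma
    (g := fun n => ∑ b ∈ s n, f b) fun n => by
      have h3 : HasSum (f ∘ (Subtype.val : {b // b ∈ s n} → β)) (∑ b ∈ s n, f b) :=
        Finset.hasSum (s n) f
      exact (Equiv.subtypeEquivRight (p := fun b => deg b = n) (q := (· ∈ s n))
        (fun b => (hs n b).symm)).hasSum_iff.2 h3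
  rwa [h2.unique ha] at h1

/-- The geometric series in several variables. -/
theorem hasSum_monomialAt {d : ℕ} (x : Fin d → ℂ) (hx : ∑ i, ‖x i‖ < 1) :
    HasSum (fun α => (multiWeight α : ℂ)⁻¹ * monomialAt α x) (1 - ∑ i, x i)⁻¹ := by
  have hx0 : 0 ≤ ∑ i, ‖x i‖ := Finset.sum_nonneg fun i _ => norm_nonneg _
  have hdisj : ∀ s : Finset ℕ,
      Set.PairwiseDisjoint (s : Set ℕ) (Finset.piAntidiag (Finset.univ : Finset (Fin d))) :=
    fun s a _ b _ hab => Finset.disjoint_left.2 fun α ha hb => hab (by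
      rw [← (Finset.mem_piAntidiag.1 ha).1, (Finset.mem_piAntidiag.1 hb).1])
  have hsum : Summable (fun α => ‖(multiWeight α : ℂ)⁻¹ * monomialAt α x‖) := by
    -- A finite set of multi-indices is enlarged to the union of the full degree layers it meets;
    -- each layer sums to a term of a geometric series.
    refine summable_of_sum_le (fun _ => norm_nonneg _) (c := (1 - ∑ i, ‖x i‖)⁻¹) fun u => ?_
    let N := u.image fun α => ∑ i, α i
    calc ∑ α ∈ u, ‖(multiWeight α : ℂ)⁻¹ * monomialAt α x‖
        ≤ ∑ α ∈ N.biUnion (Finset.piAntidiag Finset.univ),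
            ‖(multiWeight α : ℂ)⁻¹ * monomialAt α x‖ := by
          refine Finset.sum_le_sum_of_subset_of_nonneg (fun α hα => ?_)
            fun _ _ _ => norm_nonneg _
          simp only [Finset.mem_biUnion, Finset.mem_piAntidiag]
          exact ⟨_, Finset.mem_image_of_mem _ hα, rfl, by simp⟩
      _ = ∑ n ∈ N, (∑ i, ‖x i‖) ^ n := by
          rw [Finset.sum_biUnion (hdisj N)]
          exact Finset.sum_congr rfl fun n _ => sum_piAntidiag_norm_monomialAt x n
      _ ≤ (1 - ∑ i, ‖x i‖)⁻¹ :=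
          sum_le_hasSum N (fun n _ => pow_nonneg hx0 n) (hasSum_geometric_of_lt_one hx0 hx)
  have h4 : ‖∑ i, x i‖ < 1 := (norm_sum_le _ _).trans_lt hx
  exact hasSum_of_hasSum_fiber (fun α => ∑ i, α i) (fun n => by simp) hsum.of_norm
    ((hasSum_geometric_of_norm_lt_one h4).congr_fun fun n => sum_piAntidiag_monomialAt x n)

/-- The reproducing kernel of the Drury-Arveson space. -/
noncomputable def daKernel {d : ℕ} (z w : EuclideanSpace ℂ (Fin d)) : ℂ := (1 - inner ℂ w z)⁻¹

theorem hasSum_daKernel {d : ℕ} (z w : UnitBall d) :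
    HasSum (fun α => (multiWeight α : ℂ)⁻¹ *
      (monomialAt α (z : EuclideanSpace ℂ (Fin d)) *
        conj (monomialAt α (w : EuclideanSpace ℂ (Fin d))))) (daKernel z.1 w.1) := by
  have hz : ‖z.1‖ < 1 := mem_ball_zero_iff.1 z.2
  have hw : ‖w.1‖ < 1 := mem_ball_zero_iff.1 w.2
  have h := hasSum_monomialAt (fun i => z.1 i * conj (w.1 i)) (by
    have h1 := Finset.sum_mul_sq_le_sq_mul_sq Finset.univ (fun i => ‖z.1 i‖) (fun i => ‖w.1 i‖)
    rw [← EuclideanSpace.norm_sq_eq, ← EuclideanSpace.norm_sq_eq, ← mul_pow] at h1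
    have h2 := abs_le_of_sq_le_sq' h1 (by positivity)
    simp only [norm_mul, RCLike.norm_conj]
    refine h2.2.trans_lt ?_
    nlinarith [norm_nonneg z.1, norm_nonneg w.1])
  have e : inner ℂ w.1 z.1 = ∑ i, z.1 i * conj (w.1 i) := by
    simp [PiLp.inner_apply]
  rw [daKernel, e]
  refine h.congr_fun fun α => ?_
  rw [← monomialAt_conj, ← monomialAt_mul]
  rfl

/-- The squared distance between the kernel functions at `z` and at `w`. -/
noncomputable def daKernelDistSq {d : ℕ} (z w : EuclideanSpace ℂ (Fin d)) : ℝ :=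
  (daKernel z z - daKernel z w - daKernel w z + daKernel w w).re

theorem hasSum_daKernelDistSq {d : ℕ} (z w : UnitBall d) :
    HasSum (fun α => (multiWeight α)⁻¹ *
      ‖monomialAt α (z : EuclideanSpace ℂ (Fin d)) -
        monomialAt α (w : EuclideanSpace ℂ (Fin d))‖ ^ 2) (daKernelDistSq z.1 w.1) := by
  have h := Complex.hasSum_re ((((hasSum_daKernel z z).sub (hasSum_daKernel z w)).sub
    (hasSum_daKernel w z)).add (hasSum_daKernel w w))
  refine h.congr_fun fun α => ?_
  rw [← Complex.ofReal_re ((multiWeight α)⁻¹ * _)]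
  congr 1
  push_cast
  rw [← Complex.mul_conj', map_sub]
  ring

/-! ### Boundary behaviour of Drury–Arveson functions -/

/-- Cauchy–Schwarz for the tail of the series against a difference of kernel functions. `S` depends
only on the tail of the norm of `F`, hence not on the two points. -/
theorem IsDruryArvesonExpansion.exists_partialSum {d : ℕ} {F : UnitBall d → ℂ}
    {c : (Fin d → ℕ) → ℂ} (h : IsDruryArvesonExpansion F c) {ε : ℝ} (hε : 0 < ε) :
    ∃ S : Finset (Fin d → ℕ), ∀ z w : UnitBall d,
      ‖F z - F w - ∑ α ∈ S, c α * (monomialAt α (z : EuclideanSpace ℂ (Fin d)) -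
        monomialAt α (w : EuclideanSpace ℂ (Fin d)))‖ ^ 2 ≤ ε * daKernelDistSq z.1 w.1 := by
  classical
  obtain ⟨S, hS⟩ := summable_iff_vanishing_norm.1 h.1 ε hε
  refine ⟨S, fun z w => ?_⟩
  set b : (Fin d → ℕ) → ℂ := fun α => monomialAt α (z : EuclideanSpace ℂ (Fin d)) -
        monomialAt α (w : EuclideanSpace ℂ (Fin d)) with hb
  have hsum : HasSum (fun α => c α * b α) (F z - F w) :=
    ((h.2 z).sub (h.2 w)).congr_fun fun α => by simp [hb, monomialAt, mul_sub]
  have hlim := ((hsum.sub_const (∑ α ∈ S, c α * b α)).norm).pow 2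
  refine le_of_tendsto hlim ?_
  filter_upwards [eventually_ge_atTop S] with T hT
  rw [← Finset.sum_sdiff hT, add_sub_cancel_right]
  have h1 : ‖∑ α ∈ T \ S, c α * b α‖ ≤
      ∑ α ∈ T \ S, (‖c α‖ * √(multiWeight α)) * (√(multiWeight α)⁻¹ * ‖b α‖) := by
    refine (norm_sum_le _ _).trans_eq (Finset.sum_congr rfl fun α _ => ?_)
    have := (Real.sqrt_pos.2 (multiWeight_pos α)).ne'
    rw [norm_mul, Real.sqrt_inv]
    field_simp
  have h2 := Finset.sum_mul_sq_le_sq_mul_sq (T \ S) (fun α => ‖c α‖ * √(multiWeight α))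
    (fun α => √(multiWeight α)⁻¹ * ‖b α‖)
  have e1 : ∀ α, (‖c α‖ * √(multiWeight α)) ^ 2 = ‖c α‖ ^ 2 * multiWeight α := fun α => by
    rw [mul_pow, Real.sq_sqrt (multiWeight_pos α).le]
  have e2 : ∀ α, (√(multiWeight α)⁻¹ * ‖b α‖) ^ 2 = (multiWeight α)⁻¹ * ‖b α‖ ^ 2 := fun α => by
    rw [mul_pow, Real.sq_sqrt (inv_nonneg.2 (multiWeight_pos α).le)]
  simp only [e1, e2] at h2
  refine ((pow_le_pow_left₀ (norm_nonneg _) h1 2).trans h2).trans ?_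
  refine mul_le_mul ?_ ?_ ?_ hε.le
  · exact (le_abs_self _).trans (hS _ Finset.sdiff_disjoint).le
  · exact sum_le_hasSum _ (fun α _ => mul_nonneg (inv_nonneg.2 (multiWeight_pos α).le)
      (sq_nonneg _)) (hasSum_daKernelDistSq z w)
  · exact Finset.sum_nonneg fun α _ => mul_nonneg (inv_nonneg.2 (multiWeight_pos α).le)
      (sq_nonneg _)

/-- A function in the Drury-Arveson space has the same boundary behaviour along two curves that
end at the same point and whose kernel functions stay at bounded distance. -/
theorem tendsto_sub_of_mem_druryArveson {d : ℕ} {F : UnitBall d → ℂ} (hF : F ∈ druryArveson d)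
    {ι : Type*} {l : Filter ι} {γ₁ γ₂ : ι → UnitBall d} {p : EuclideanSpace ℂ (Fin d)}
    (h₁ : Tendsto (fun t => (γ₁ t : EuclideanSpace ℂ (Fin d))) l (𝓝 p))
    (h₂ : Tendsto (fun t => (γ₂ t : EuclideanSpace ℂ (Fin d))) l (𝓝 p))
    {K : ℝ} (hK : ∀ᶠ t in l, daKernelDistSq (γ₁ t).1 (γ₂ t).1 ≤ K) :
    Tendsto (fun t => F (γ₁ t) - F (γ₂ t)) l (𝓝 0) := by
  obtain ⟨c, hc⟩ := hF
  rw [Metric.tendsto_nhds]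
  intro ε hε
  obtain ⟨S, hS⟩ := hc.exists_partialSum (ε := (ε / 2) ^ 2 / (|K| + 1)) (by positivity)
  have hP : Tendsto (fun t => ∑ α ∈ S, c α * (monomialAt α (γ₁ t : EuclideanSpace ℂ (Fin d)) -
        monomialAt α (γ₂ t : EuclideanSpace ℂ (Fin d)))) l (𝓝 0) := by
    have h := tendsto_finsetSum S fun α _ =>
      ((((continuous_monomialAt α).tendsto p).comp h₁).sub
        (((continuous_monomialAt α).tendsto p).comp h₂)).const_mul (c α)
    simpa using h
  filter_upwards [hK, Metric.tendsto_nhds.1 hP (ε / 2) (by positivity)] with t ht1 ht2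
  rw [dist_zero_right] at ht2 ⊢
  have h3 : ‖F (γ₁ t) - F (γ₂ t) - ∑ α ∈ S, c α *
      (monomialAt α (γ₁ t : EuclideanSpace ℂ (Fin d)) -
        monomialAt α (γ₂ t : EuclideanSpace ℂ (Fin d)))‖ ≤ ε / 2 := by
    refine abs_le_of_sq_le_sq' ((hS _ _).trans ?_) (by positivity) |>.2
    rw [div_mul_eq_mul_div, div_le_iff₀ (by positivity)]
    exact mul_le_mul_of_nonneg_left (by linarith [le_abs_self K]) (by positivity)
  have h4 := norm_sub_norm_le (F (γ₁ t) - F (γ₂ t)) (∑ α ∈ S, c α *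
      (monomialAt α (γ₁ t : EuclideanSpace ℂ (Fin d)) -
        monomialAt α (γ₂ t : EuclideanSpace ℂ (Fin d))))
  linarith

/-! ### Constants and coordinate multipliers -/

theorem one_mem_druryArveson (d : ℕ) : (1 : UnitBall d → ℂ) ∈ druryArveson d := by
  classical
  refine ⟨Pi.single 0 1, summable_of_ne_finset_zero (s := {0}) fun α hα => ?_, fun z => ?_⟩
  · rw [Finset.mem_singleton] at hα
    simp [Pi.single_eq_of_ne hα]
  · have := hasSum_single (f := fun α : Fin d → ℕ => (Pi.single 0 1 : (Fin d → ℕ) → ℂ) α *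
      ∏ i, z.1 i ^ α i) 0 fun α hα => by simp [Pi.single_eq_of_ne hα]
    simpa using this

theorem mem_druryArveson_of_mem_multiplierAlgebra {d : ℕ} {φ : UnitBall d → ℂ}
    (hφ : φ ∈ multiplierAlgebra d) : φ ∈ druryArveson d := by
  simpa using hφ 1 (one_mem_druryArveson d)

/-- The weight is multiplied by `(α j + 1) / (|α| + 1) ≤ 1`; hence multiplication by a coordinate
does not increase the norm. -/
theorem multiWeight_add_single_le {d : ℕ} (α : Fin d → ℕ) (j : Fin d) :
    multiWeight (α + Pi.single j 1) ≤ multiWeight α := by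
  have e1 : ∏ i, ((α + Pi.single j 1 : Fin d → ℕ) i).factorial
      = (α j + 1) * ∏ i, (α i).factorial := by
    rw [← Finset.mul_prod_erase _ _ (Finset.mem_univ j),
      ← Finset.mul_prod_erase _ (fun i => (α i).factorial) (Finset.mem_univ j), ← mul_assoc]
    congr 1
    · simp [Nat.factorial_succ]
    · refine Finset.prod_congr rfl fun i hi => ?_
      simp [Pi.single_eq_of_ne (Finset.ne_of_mem_erase hi)]
  have e2 : ∑ i, (α + Pi.single j 1 : Fin d → ℕ) i = ∑ i, α i + 1 := by
    simp [Finset.sum_add_distrib]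
  have h : α j ≤ ∑ i, α i := Finset.single_le_sum (fun _ _ => Nat.zero_le _) (Finset.mem_univ j)
  have h0 : 0 < (∑ i, α i).factorial := Nat.factorial_pos _
  unfold multiWeight
  rw [e1, e2, Nat.factorial_succ, div_le_div_iff₀ (by positivity) (by positivity)]
  norm_cast
  calc _ = (α j + 1) * ((∏ i, (α i).factorial) * (∑ i, α i).factorial) := by ring
    _ ≤ (∑ i, α i + 1) * ((∏ i, (α i).factorial) * (∑ i, α i).factorial) := by gcongr
    _ = _ := by ring

theorem coordinate_mem_multiplierAlgebra {d : ℕ} (j : Fin d) :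
    (fun z : UnitBall d => (z : EuclideanSpace ℂ (Fin d)) j) ∈ multiplierAlgebra d := by
  rintro F ⟨c, hc, hF⟩
  have hinj : Function.Injective fun α : Fin d → ℕ => α + Pi.single j 1 :=
    add_left_injective _
  refine ⟨Function.extend (fun α => α + Pi.single j 1) c 0, ?_, fun z => ?_⟩
  · rw [← hinj.summable_iff fun α hα => by simp [Function.extend_apply' _ _ _ hα]]
    refine hc.of_nonneg_of_le (fun α => ?_) fun α => ?_
    · have := multiWeight_pos (α + Pi.single j 1)
      simp only [Function.comp_apply]
      positivity
    · simp only [Function.comp_apply, hinj.extend_apply]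
      exact mul_le_mul_of_nonneg_left (multiWeight_add_single_le α j) (sq_nonneg _)
  · rw [← hinj.hasSum_iff fun α hα => by simp [Function.extend_apply' _ _ _ hα]]
    refine ((hF z).mul_left (z.1 j)).congr_fun fun α => ?_
    simp only [Function.comp_apply, hinj.extend_apply, Pi.add_apply, pow_add,
      Finset.prod_mul_distrib]
    have : ∏ i, z.1 i ^ (Pi.single j 1 : Fin d → ℕ) i = z.1 j := by
      rw [Finset.prod_eq_single j (fun i _ hi => by simp [Pi.single_eq_of_ne hi]) (by simp)]
      simp
    rw [this]
    ring

/-! ### Kernel asymptotics at a point of the sphere -/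

/-- In `⟨p - t w + q, p - t v + r⟩` the linear term is `-t (⟨p, v⟩ + ⟨w, p⟩) = -2t`, whichever
directions are paired; everything else is quadratic in `t`. -/
theorem norm_inner_sub_le_of_quadratic_approx {E : Type*} [NormedAddCommGroup E]
    [InnerProductSpace ℂ E] {p v w x y : E} (hp : ‖p‖ = 1) (hv : inner ℂ p v = 1)
    (hw : inner ℂ p w = 1) {C t : ℝ} (ht0 : 0 ≤ t) (ht1 : t ≤ 1)
    (hx : ‖x - p + (t : ℂ) • v‖ ≤ C * t ^ 2) (hy : ‖y - p + (t : ℂ) • w‖ ≤ C * t ^ 2) :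
    ‖1 - inner ℂ y x - 2 * t‖ ≤
      (‖w‖ * ‖v‖ + (1 + ‖w‖) * C + C * (1 + ‖v‖ + C)) * t ^ 2 := by
  set r := x - p + (t : ℂ) • v with hr
  set q := y - p + (t : ℂ) • w with hq
  have hx' : x = p - (t : ℂ) • v + r := by rw [hr]; abel
  have hy' : y = p - (t : ℂ) • w + q := by rw [hq]; abel
  have hw' : inner ℂ w p = 1 := by rw [← inner_conj_symm, hw, map_one]
  have hpp : inner ℂ p p = 1 := by rw [inner_self_eq_norm_sq_to_K, hp]; simp
  have e : 1 - inner ℂ y x - 2 * t =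
      -((t : ℂ) ^ 2 * inner ℂ w v + inner ℂ (p - (t : ℂ) • w) r + inner ℂ q x) := by
    have : inner ℂ y x = inner ℂ (p - (t : ℂ) • w) (p - (t : ℂ) • v)
        + inner ℂ (p - (t : ℂ) • w) r + inner ℂ q x := by
      rw [← inner_add_right, ← hx', ← inner_add_left, ← hy']
    rw [this]
    simp only [inner_sub_left, inner_sub_right, inner_smul_left, inner_smul_right, hpp, hv, hw',
      Complex.conj_ofReal]
    ring
  have hC : 0 ≤ C * t ^ 2 := (norm_nonneg _).trans hx
  have b : ∀ u : E, ‖p - (t : ℂ) • u‖ ≤ 1 + ‖u‖ := fun u => by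
    refine (norm_sub_le _ _).trans ?_
    rw [hp, norm_smul, Complex.norm_real, Real.norm_of_nonneg ht0]
    nlinarith [norm_nonneg u]
  rcases ht0.eq_or_lt with rfl | ht
  · have h1 : r = 0 := by simpa using hx
    have h2 : q = 0 := by simpa using hy
    rw [e, h1, h2]; simp
  have hC0 : 0 ≤ C := by
    by_contra h
    nlinarith [pow_pos ht 2]
  have hxn : ‖x‖ ≤ 1 + ‖v‖ + C := by
    rw [hx']
    refine (norm_add_le _ _).trans (add_le_add (b v) (hx.trans ?_))
    nlinarith [pow_le_one₀ (n := 2) ht0 ht1]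
  rw [e, norm_neg]
  refine (norm_add₃_le).trans ?_
  have i1 : ‖(t : ℂ) ^ 2 * inner ℂ w v‖ ≤ t ^ 2 * (‖w‖ * ‖v‖) := by
    rw [norm_mul, norm_pow, Complex.norm_real, Real.norm_of_nonneg ht0]
    exact mul_le_mul_of_nonneg_left (norm_inner_le_norm _ _) (by positivity)
  have i2 : ‖inner ℂ (p - (t : ℂ) • w) r‖ ≤ (1 + ‖w‖) * (C * t ^ 2) :=
    (norm_inner_le_norm _ _).trans (mul_le_mul (b w) hx (norm_nonneg _) (by positivity))
  have i3 : ‖inner ℂ q x‖ ≤ (C * t ^ 2) * (1 + ‖v‖ + C) :=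
    (norm_inner_le_norm _ _).trans (mul_le_mul hy hxn (norm_nonneg _) hC)
  linarith

/-- With `X = 1 - ⟨y, x⟩`, the condition `M t ≤ 1` forces `‖X‖ ≥ t`, so `‖1/X - 1/(2t)‖ ≤ M t² / (2t
· t)`. -/
theorem norm_daKernel_sub_le {d : ℕ} {x y : EuclideanSpace ℂ (Fin d)} {M t : ℝ} (ht : 0 < t)
    (hMt : M * t ≤ 1) (h : ‖1 - inner ℂ y x - 2 * t‖ ≤ M * t ^ 2) :
    ‖daKernel x y - (2 * (t : ℂ))⁻¹‖ ≤ M / 2 := by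
  set X : ℂ := 1 - inner ℂ y x with hX
  have h2t : ‖(2 * (t : ℂ))‖ = 2 * t := by simp [abs_of_pos ht]
  have hle : M * t ^ 2 ≤ t := by nlinarith
  have hXt : t ≤ ‖X‖ := by
    have := norm_sub_norm_le (2 * (t : ℂ)) X
    rw [h2t, norm_sub_rev (2 * (t : ℂ)) X] at this
    linarith
  have hX0 : X ≠ 0 := norm_pos_iff.1 (ht.trans_le hXt)
  have ht0 : (2 * (t : ℂ)) ≠ 0 := norm_pos_iff.1 (by rw [h2t]; positivity)
  have hM : 0 ≤ M * t ^ 2 := (norm_nonneg _).trans h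
  rw [daKernel, ← hX, inv_sub_inv hX0 ht0, norm_div, norm_mul, h2t, norm_sub_rev,
    div_le_iff₀ (by positivity)]
  refine h.trans ?_
  have hM0 : 0 ≤ M := nonneg_of_mul_nonneg_left hM (by positivity)
  nlinarith [mul_le_mul_of_nonneg_left hXt (mul_nonneg hM0 ht.le)]

theorem daKernelDistSq_le_of_norm_sub_le {d : ℕ} {x y : EuclideanSpace ℂ (Fin d)} {k : ℂ} {K : ℝ}
    (h₁ : ‖daKernel x x - k‖ ≤ K) (h₂ : ‖daKernel x y - k‖ ≤ K) (h₃ : ‖daKernel y x - k‖ ≤ K)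
    (h₄ : ‖daKernel y y - k‖ ≤ K) : daKernelDistSq x y ≤ 4 * K := by
  have e : daKernel x x - daKernel x y - daKernel y x + daKernel y y =
      (daKernel x x - k) - (daKernel x y - k) - (daKernel y x - k) + (daKernel y y - k) := by ring
  rw [daKernelDistSq, e]
  refine (Complex.re_le_norm _).trans ?_
  have i1 := norm_add_le ((daKernel x x - k) - (daKernel x y - k) - (daKernel y x - k))
    (daKernel y y - k)
  have i2 := norm_sub_le ((daKernel x x - k) - (daKernel x y - k)) (daKernel y x - k)
  have i3 := norm_sub_le (daKernel x x - k) (daKernel x y - k)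
  linarith

/-- Two curves that approach a point `p` of the sphere, with the same speed in the direction of
`p`, have kernel functions at bounded distance. -/
theorem exists_daKernelDistSq_le {d : ℕ} {p v w : EuclideanSpace ℂ (Fin d)} (hp : ‖p‖ = 1)
    (hv : inner ℂ p v = 1) (hw : inner ℂ p w = 1) {γ δ : ℝ → EuclideanSpace ℂ (Fin d)} {C : ℝ}
    (hγ : ∀ᶠ t in 𝓝[>] 0, ‖γ t - p + (t : ℂ) • v‖ ≤ C * t ^ 2)
    (hδ : ∀ᶠ t in 𝓝[>] 0, ‖δ t - p + (t : ℂ) • w‖ ≤ C * t ^ 2) :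
    ∃ K, ∀ᶠ t in 𝓝[>] 0, daKernelDistSq (γ t) (δ t) ≤ K := by
  -- `c` is the constant of `norm_inner_sub_le_of_quadratic_approx`, and `M` dominates it for all
  -- four pairings.
  let c : EuclideanSpace ℂ (Fin d) → EuclideanSpace ℂ (Fin d) → ℝ := fun u u' =>
    ‖u'‖ * ‖u‖ + (1 + ‖u'‖) * C + C * (1 + ‖u‖ + C)
  let M : ℝ := |c v v| + |c v w| + |c w v| + |c w w|
  have m1 : c v v ≤ M := by
    linarith [le_abs_self (c v v), abs_nonneg (c v w), abs_nonneg (c w v), abs_nonneg (c w w)]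
  have m2 : c v w ≤ M := by
    linarith [le_abs_self (c v w), abs_nonneg (c v v), abs_nonneg (c w v), abs_nonneg (c w w)]
  have m3 : c w v ≤ M := by
    linarith [le_abs_self (c w v), abs_nonneg (c v w), abs_nonneg (c v v), abs_nonneg (c w w)]
  have m4 : c w w ≤ M := by
    linarith [le_abs_self (c w w), abs_nonneg (c v w), abs_nonneg (c w v), abs_nonneg (c v v)]
  have hM : Tendsto (fun t : ℝ => M * t) (𝓝[>] 0) (𝓝 0) := by
    have : Tendsto (fun t : ℝ => M * t) (𝓝 0) (𝓝 (M * 0)) := tendsto_id.const_mul M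
    rw [mul_zero] at this
    exact this.mono_left nhdsWithin_le_nhds
  refine ⟨4 * (M / 2), ?_⟩
  filter_upwards [hγ, hδ, hM.eventually_le_const one_pos, self_mem_nhdsWithin,
    Ioc_mem_nhdsGT one_pos] with t h1 h2 h3 h4 h5
  have key : ∀ {u u' x y : EuclideanSpace ℂ (Fin d)}, inner ℂ p u = 1 → inner ℂ p u' = 1 →
      ‖x - p + (t : ℂ) • u‖ ≤ C * t ^ 2 → ‖y - p + (t : ℂ) • u'‖ ≤ C * t ^ 2 → c u u' ≤ M →
      ‖daKernel x y - (2 * (t : ℂ))⁻¹‖ ≤ M / 2 := fun hu hu' hx hy hc =>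
    norm_daKernel_sub_le h5.1 h3
      ((norm_inner_sub_le_of_quadratic_approx hp hu hu' h5.1.le h5.2 hx hy).trans
        (mul_le_mul_of_nonneg_right hc (sq_nonneg t)))
  exact daKernelDistSq_le_of_norm_sub_le (key hv hv h1 h1 m1) (key hv hw h1 h2 m2)
    (key hw hv h2 h1 m3) (key hw hw h2 h2 m4)

/-! ### Radial behaviour of holomorphic discs at the boundary -/

theorem sq_norm_one_sub_conj_mul_sub (a b : ℂ) :
    ‖1 - conj a * b‖ ^ 2 - ‖b - a‖ ^ 2 = (1 - ‖a‖ ^ 2) * (1 - ‖b‖ ^ 2) := by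
  simp only [Complex.sq_norm, Complex.normSq_apply, Complex.sub_re, Complex.sub_im, Complex.mul_re,
    Complex.mul_im, Complex.conj_re, Complex.conj_im, Complex.one_re, Complex.one_im]
  ring

/-- A consequence of the Schwarz-Pick lemma: a holomorphic self-map of the disc approaches the
circle at most linearly fast. -/
theorem one_sub_sq_norm_le_of_mapsTo_ball {h : ℂ → ℂ} (hd : DifferentiableOn ℂ h (ball 0 1))
    (hm : Set.MapsTo h (ball 0 1) (ball 0 1)) {z : ℂ} (hz : z ∈ ball (0 : ℂ) 1) :
    (1 - ‖h 0‖) ^ 2 * (1 - ‖z‖ ^ 2) ≤ 1 - ‖h z‖ ^ 2 := by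
  have hlt : ∀ w ∈ ball (0 : ℂ) 1, ‖h w‖ < 1 := fun w hw => mem_ball_zero_iff.1 (hm hw)
  have h0 : ‖h 0‖ < 1 := hlt 0 (mem_ball_self one_pos)
  have hden : ∀ w ∈ ball (0 : ℂ) 1, 1 - ‖h 0‖ ≤ ‖1 - conj (h 0) * h w‖ := fun w hw => by
    have i := norm_sub_norm_le (1 : ℂ) (conj (h 0) * h w)
    rw [norm_mul, RCLike.norm_conj, norm_one] at i
    nlinarith [hlt w hw, norm_nonneg (h 0), norm_nonneg (h w)]
  have hpos : ∀ w ∈ ball (0 : ℂ) 1, 0 < ‖1 - conj (h 0) * h w‖ := fun w hw =>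
    (sub_pos.2 h0).trans_le (hden w hw)
  -- Schwarz lemma for `h` followed by the Möbius map that sends `h 0` to `0`.
  have hφ := Complex.norm_le_norm_of_mapsTo_ball
    (f := fun w => (h w - h 0) / (1 - conj (h 0) * h w)) (R := 1) (z := z)
    ((hd.sub_const _).div ((hd.const_mul _).const_sub _) fun w hw => norm_pos_iff.1 (hpos w hw))
    (fun w hw => by
      rw [mem_closedBall_zero_iff, norm_div, div_le_one (hpos w hw)]
      refine abs_le_of_sq_le_sq' ?_ (norm_nonneg _) |>.2
      have i1 := sq_norm_one_sub_conj_mul_sub (h 0) (h w)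
      have i2 : 0 ≤ 1 - ‖h w‖ ^ 2 := by nlinarith [hlt w hw, norm_nonneg (h w)]
      have i3 : 0 ≤ 1 - ‖h 0‖ ^ 2 := by nlinarith [norm_nonneg (h 0)]
      nlinarith [mul_nonneg i3 i2])
    (by simp) (mem_ball_zero_iff.1 hz)
  rw [norm_div, div_le_iff₀ (hpos z hz)] at hφ
  have i1 := sq_norm_one_sub_conj_mul_sub (h 0) (h z)
  have i2 := pow_le_pow_left₀ (norm_nonneg _) hφ 2
  have i3 : 0 ≤ 1 - ‖z‖ ^ 2 := by nlinarith [mem_ball_zero_iff.1 hz, norm_nonneg z]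
  have i4 := pow_le_pow_left₀ (sub_pos.2 h0).le (hden z hz) 2
  have i5 : 0 ≤ 1 - ‖h z‖ ^ 2 := by nlinarith [hlt z hz, norm_nonneg (h z)]
  nlinarith [mul_le_mul_of_nonneg_right i4 i3, mul_nonneg i5 (sq_nonneg ‖h 0‖)]

/-- The Cauchy–Riemann equations pass from the open disc to the circle by continuity of the
derivative. -/
theorem fderivWithin_closedBall_mul_I {h : ℂ → ℂ} (hd : DifferentiableOn ℂ h (ball 0 1))
    (hc : ContDiffOn ℝ 1 h (closedBall 0 1)) {z : ℂ} (hz : z ∈ closedBall (0 : ℂ) 1) (w : ℂ) :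
    fderivWithin ℝ h (closedBall 0 1) z (Complex.I * w) =
      Complex.I * fderivWithin ℝ h (closedBall 0 1) z w := by
  have hu : UniqueDiffOn ℝ (closedBall (0 : ℂ) 1) :=
    uniqueDiffOn_convex (convex_closedBall 0 1)
      (by rw [interior_closedBall 0 one_ne_zero]; exact nonempty_ball.2 one_pos)
  have hcont := hc.continuousOn_fderivWithin hu le_rfl
  have heq : Set.EqOn (fun z => fderivWithin ℝ h (closedBall 0 1) z (Complex.I * w))
      (fun z => Complex.I * fderivWithin ℝ h (closedBall 0 1) z w) (ball 0 1) := fun x hx => by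
    have hx' : closedBall (0 : ℂ) 1 ∈ 𝓝 x :=
      mem_of_superset (isOpen_ball.mem_nhds hx) ball_subset_closedBall
    have hdx := hd.differentiableAt (isOpen_ball.mem_nhds hx)
    simp only [fderivWithin_of_mem_nhds hx', hdx.fderiv_restrictScalars ℝ]
    simp [mul_assoc]
  refine heq.of_subset_closure (hcont.clm_apply continuousOn_const)
    (continuousOn_const.mul (hcont.clm_apply continuousOn_const)) ball_subset_closedBall
    (by rw [closure_ball 0 one_ne_zero]) hz

/-- The angular derivative of a holomorphic self-map of the disc at a boundary fixed value,
for maps that are `C^1` up to the boundary. -/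
theorem exists_pos_hasDerivWithinAt_radial {h : ℂ → ℂ} (hd : DifferentiableOn ℂ h (ball 0 1))
    (hm : Set.MapsTo h (ball 0 1) (ball 0 1)) (hc : ContDiffOn ℝ 1 h (closedBall 0 1))
    {ξ : ℂ} (hξ : ‖ξ‖ = 1) (hsphere : ∀ z : ℂ, ‖z‖ = 1 → ‖h z‖ ≤ 1) (h1 : h ξ = 1) :
    ∃ a : ℝ, 0 < a ∧ HasDerivWithinAt (fun s : ℝ => h ((1 - s) * ξ)) (-(a : ℂ)) (Set.Icc 0 1) 0 := by
  have hξ' : ξ ∈ closedBall (0 : ℂ) 1 := by simp [hξ]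
  set A := fderivWithin ℝ h (closedBall 0 1) ξ with hA
  have hA' : HasFDerivWithinAt h A (closedBall 0 1) ξ :=
    ((hc ξ hξ').differentiableWithinAt one_ne_zero).hasFDerivWithinAt
  have hnorm : ∀ s ∈ Set.Icc (0 : ℝ) 1, ‖(1 - (s : ℂ)) * ξ‖ = 1 - s := fun s hs => by
    rw [norm_mul, hξ, mul_one, ← Complex.ofReal_one, ← Complex.ofReal_sub, Complex.norm_real,
      Real.norm_of_nonneg (by linarith [hs.2])]
  have hrad : HasDerivWithinAt (fun s : ℝ => h ((1 - s) * ξ)) (A (-ξ)) (Set.Icc 0 1) 0 := by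
    have hl : HasDerivWithinAt (fun s : ℝ => (1 - (s : ℂ)) * ξ) (-ξ) (Set.Icc 0 1) 0 := by
      have := ((Complex.ofRealCLM.hasDerivAt (x := 0)).const_sub (1 : ℂ)).mul_const ξ
      simpa using this.hasDerivWithinAt
    refine HasFDerivWithinAt.comp_hasDerivWithinAt_of_eq (0 : ℝ) hA' hl (fun s hs => ?_) (by simp)
    rw [mem_closedBall_zero_iff, hnorm s hs]
    linarith [hs.1]
  -- On the circle `Re h` is maximal at `ξ`, so its tangential derivative `Re A(iξ) = -Im A(ξ)`
  -- vanishes.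
  have him : (A ξ).im = 0 := by
    have hl : HasDerivAt (fun θ : ℝ => Complex.exp (θ * Complex.I) * ξ) (Complex.I * ξ) 0 := by
      have := (((Complex.ofRealCLM.hasDerivAt (x := 0)).mul_const Complex.I).cexp).mul_const ξ
      simpa using this
    have hcirc : ∀ θ : ℝ, ‖Complex.exp (θ * Complex.I) * ξ‖ = 1 := fun θ => by
      rw [norm_mul, Complex.norm_exp_ofReal_mul_I, hξ, mul_one]
    have hcomp : HasDerivAt (fun θ : ℝ => h (Complex.exp (θ * Complex.I) * ξ))
        (A (Complex.I * ξ)) 0 := by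
      rw [← hasDerivWithinAt_univ] at hl ⊢
      refine HasFDerivWithinAt.comp_hasDerivWithinAt_of_eq (0 : ℝ) hA' hl (fun s _ => ?_) (by simp)
      rw [mem_closedBall_zero_iff, hcirc]
    have hre : HasDerivAt (fun θ : ℝ => (h (Complex.exp (θ * Complex.I) * ξ)).re)
        (A (Complex.I * ξ)).re 0 := Complex.reCLM.hasFDerivAt.comp_hasDerivAt (0 : ℝ) hcomp
    have hmax : IsLocalMax (fun θ : ℝ => (h (Complex.exp (θ * Complex.I) * ξ)).re) 0 :=
      Eventually.of_forall fun θ => by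
        simp only [Complex.ofReal_zero, zero_mul, Complex.exp_zero, one_mul, h1, Complex.one_re]
        exact (Complex.re_le_norm _).trans (hsphere _ (hcirc θ))
    have h0 := hmax.hasDerivAt_eq_zero hre
    rw [fderivWithin_closedBall_mul_I hd hc hξ'] at h0
    simpa using h0
  have hAξ : A ξ = ((A ξ).re : ℂ) := Complex.ext (by simp) (by simp [him])
  have hc0 : 0 < (1 - ‖h 0‖) ^ 2 :=
    pow_pos (sub_pos.2 (mem_ball_zero_iff.1 (hm (mem_ball_self one_pos)))) 2
  refine ⟨(A ξ).re, ?_, by rwa [← hAξ, ← map_neg]⟩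
  have hre : HasDerivWithinAt (fun s : ℝ => (h ((1 - s) * ξ)).re) (A (-ξ)).re (Set.Icc 0 1) 0 :=
    Complex.reCLM.hasFDerivAt.comp_hasDerivWithinAt (0 : ℝ) hrad
  rw [hasDerivWithinAt_iff_tendsto_slope, Set.Icc_sdiff_left,
    nhdsWithin_Ioc_eq_nhdsGT one_pos] at hre
  -- With `c = (1 - ‖h 0‖)²`, Schwarz–Pick gives `1 - ‖h‖² ≥ c s (2 - s) ≥ c s` at radius `1 - s`.
  -- As `1 - ‖h‖² ≤ 2 (1 - ‖h‖)`, it follows that `1 - Re h ≥ c s / 2`.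
  have hle := le_of_tendsto hre (b := -((1 - ‖h 0‖) ^ 2 / 2)) (by
    filter_upwards [Ioc_mem_nhdsGT one_pos] with s hs
    have hn := hnorm s ⟨hs.1.le, hs.2⟩
    have hz : (1 - (s : ℂ)) * ξ ∈ ball (0 : ℂ) 1 := by
      rw [mem_ball_zero_iff, hn]; linarith [hs.1]
    have i1 := one_sub_sq_norm_le_of_mapsTo_ball hd hm hz
    have i2 := mem_ball_zero_iff.1 (hm hz)
    have i3 := Complex.re_le_norm (h ((1 - s) * ξ))
    rw [hn] at i1
    rw [slope_def_field, sub_zero, div_le_iff₀ hs.1]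
    simp only [Complex.ofReal_zero, sub_zero, one_mul, h1, Complex.one_re]
    nlinarith [mul_nonneg hc0.le (mul_nonneg hs.1.le (sub_nonneg.2 hs.2)),
      sq_nonneg (1 - ‖h ((1 - s) * ξ)‖)])
  rw [map_neg, Complex.neg_re] at hle
  linarith

/-- Second order expansion along a radius of a disc attached to the sphere. The first order term
is transversal to the sphere. -/
theorem exists_radial_expansion {E : Type*} [NormedAddCommGroup E] [InnerProductSpace ℂ E]
    {f : ℂ → E} (hd : DifferentiableOn ℂ f (ball 0 1))
    (hm : Set.MapsTo f (ball 0 1) (ball 0 1)) (hc : ContDiffOn ℝ 2 f (closedBall 0 1))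
    (hs : ∀ z : ℂ, ‖z‖ = 1 → ‖f z‖ = 1) {ξ : ℂ} (hξ : ‖ξ‖ = 1) :
    ∃ a : ℝ, 0 < a ∧ ∃ (v : E) (C : ℝ), inner ℂ (f ξ) v = 1 ∧ ∀ t ∈ Set.Icc 0 a,
      ‖f ((1 - (t / a : ℝ)) * ξ) - f ξ + (t : ℂ) • v‖ ≤ C * t ^ 2 := by
  have hp : ‖f ξ‖ = 1 := hs ξ hξ
  have hle : ∀ z, ‖inner ℂ (f ξ) (f z)‖ ≤ ‖f z‖ := fun z =>
    (norm_inner_le_norm _ _).trans_eq (by rw [hp, one_mul])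
  obtain ⟨a, ha, hder⟩ := exists_pos_hasDerivWithinAt_radial
    (h := fun z => innerSL ℂ (f ξ) (f z))
    ((innerSL ℂ (f ξ)).differentiable.comp_differentiableOn hd)
    (fun z hz => by
      rw [mem_ball_zero_iff]
      exact (hle z).trans_lt (mem_ball_zero_iff.1 (hm hz)))
    (((innerSL ℂ (f ξ)).restrictScalars ℝ).contDiff.comp_contDiffOn (hc.of_le one_le_two))
    hξ (fun z hz => (hle z).trans_eq (hs z hz))
    (by rw [innerSL_apply_apply, inner_self_eq_norm_sq_to_K, hp]; simp)
  set φ : ℝ → E := fun s => f ((1 - s) * ξ) with hφ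
  have hφc : ContDiffOn ℝ 2 φ (Set.Icc 0 1) := by
    refine hc.comp (ContDiff.contDiffOn
      ((contDiff_const.sub Complex.ofRealCLM.contDiff).mul contDiff_const)) fun s hs => ?_
    rw [mem_closedBall_zero_iff, norm_mul, hξ, mul_one, ← Complex.ofReal_one,
      ← Complex.ofReal_sub, Complex.norm_real, Real.norm_of_nonneg (by linarith [hs.2])]
    linarith [hs.1]
  have h0 : (0 : ℝ) ∈ Set.Icc (0 : ℝ) 1 := ⟨le_rfl, zero_le_one⟩
  set D := derivWithin φ (Set.Icc 0 1) 0 with hD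
  have hφd : HasDerivWithinAt φ D (Set.Icc 0 1) 0 :=
    ((hφc 0 h0).differentiableWithinAt two_ne_zero).hasDerivWithinAt
  have hinner : inner ℂ (f ξ) D = -(a : ℂ) := by
    have h := ((innerSL ℂ (f ξ)).restrictScalars ℝ).hasFDerivAt.comp_hasDerivWithinAt (0 : ℝ) hφd
    exact (uniqueDiffOn_Icc_zero_one 0 h0).eq_deriv _ h hder
  obtain ⟨C, hC⟩ := exists_taylor_mean_remainder_bound (n := 1) zero_le_one hφc
  have ha' : (a : ℂ) ≠ 0 := Complex.ofReal_ne_zero.2 ha.ne'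
  -- The substitution `s = t / a` turns the inward speed `a` into `1` and divides the Taylor
  -- constant by `a²`.
  refine ⟨a, ha, -((a : ℂ)⁻¹ • D), C / a ^ 2, ?_, fun t ht => ?_⟩
  · rw [inner_neg_right, inner_smul_right, hinner]
    field_simp
  · have h := hC (t / a) ⟨by have := ht.1; positivity, (div_le_one ha).2 ht.2⟩
    rw [taylorWithinEval_succ, taylor_within_zero_eval, iteratedDerivWithin_one, ← hD] at h
    have e1 : φ 0 = f ξ := by simp [hφ]
    have e2 : (t : ℂ) • -((a : ℂ)⁻¹ • D) = -((t / a) • D) := by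
      rw [smul_neg, smul_smul, ← Complex.ofReal_inv, ← Complex.ofReal_mul, Complex.coe_smul,
        div_eq_mul_inv]
    have e3 : C * (t / a - 0) ^ (1 + 1) = C / a ^ 2 * t ^ 2 := by
      rw [sub_zero, one_add_one_eq_two, div_pow]
      ring
    rw [e1, e3] at h
    rw [e2]
    convert h using 2
    simp only [hφ]
    simp
    abel

/-! ### Transfer of boundary self-crossings -/

namespace IsAttachedDisc

variable {d e : ℕ} {V : Set (UnitBall d)} {W : Set (UnitBall e)}
  {f : ℂ → EuclideanSpace ℂ (Fin d)} {g : ℂ → EuclideanSpace ℂ (Fin e)}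

/-- A function on the disc that has boundary values and factors through `f` with a factor in the
Drury-Arveson space takes the same value at boundary points identified by `f`. -/
theorem eq_of_mem_druryArveson (hf : IsAttachedDisc V f) {ψ : UnitBall d → ℂ}
    (hψ : ψ ∈ druryArveson d) {u : ℂ → ℂ} (hu : ContinuousOn u (closedBall 0 1))
    (hψu : ∀ z : Disc, u z = ψ ⟨f z, hf.mapsTo z.2⟩) {ξ ζ : ℂ} (hξ : ‖ξ‖ = 1) (hζ : ‖ζ‖ = 1)
    (h : f ξ = f ζ) : u ξ = u ζ := by
  have hs : ∀ z : ℂ, ‖z‖ = 1 → ‖f z‖ = 1 := fun z hz =>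
    (hf.norm_eq_one_iff z (mem_closedBall_zero_iff.2 hz.le)).2 hz
  obtain ⟨a, ha, v, C, hv, hC⟩ := exists_radial_expansion hf.analytic.differentiableOn hf.mapsTo
    hf.contDiffOn hs hξ
  obtain ⟨b, hb, w, C', hw, hC'⟩ := exists_radial_expansion hf.analytic.differentiableOn hf.mapsTo
    hf.contDiffOn hs hζ
  rw [← h] at hw hC'
  have hm : 0 < min a b := lt_min ha hb
  obtain ⟨K, hK⟩ := exists_daKernelDistSq_le (hs ξ hξ) hv hw
    (γ := fun t => f ((1 - (t / a : ℝ)) * ξ)) (δ := fun t => f ((1 - (t / b : ℝ)) * ζ))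
    (C := max C C')
    (by
      filter_upwards [Ioo_mem_nhdsGT hm] with t ht
      exact (hC t ⟨ht.1.le, ht.2.le.trans (min_le_left _ _)⟩).trans
        (mul_le_mul_of_nonneg_right (le_max_left _ _) (sq_nonneg t)))
    (by
      filter_upwards [Ioo_mem_nhdsGT hm] with t ht
      exact (hC' t ⟨ht.1.le, ht.2.le.trans (min_le_right _ _)⟩).trans
        (mul_le_mul_of_nonneg_right (le_max_right _ _) (sq_nonneg t)))
  -- Passing to the subtype keeps both radial curves inside the open disc for every parameter, so
  -- that `ψ` can be evaluated along them.
  let l : Filter (Set.Ioo 0 (min a b)) := comap Subtype.val (𝓝[>] (0 : ℝ))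
  have hl : Tendsto (Subtype.val : Set.Ioo 0 (min a b) → ℝ) l (𝓝[>] 0) := tendsto_comap
  have : l.NeBot := comap_coe_neBot_of_le_principal (le_principal_iff.2 (Ioo_mem_nhdsGT hm))
  have hball : ∀ {c : ℝ} {η : ℂ}, ‖η‖ = 1 → min a b ≤ c → ∀ t : Set.Ioo 0 (min a b),
      (1 - (t / c : ℝ)) * η ∈ ball (0 : ℂ) 1 := fun {c η} hη hc t => by
    have h1 : 0 < c := hm.trans_le hc
    have h2 : (t : ℝ) / c < 1 := (div_lt_one h1).2 (t.2.2.trans_le hc)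
    have h3 : 0 < (t : ℝ) / c := div_pos t.2.1 h1
    rw [mem_ball_zero_iff, norm_mul, hη, mul_one, ← Complex.ofReal_one, ← Complex.ofReal_sub,
      Complex.norm_real, Real.norm_of_nonneg (by linarith)]
    linarith
  have hlim : ∀ {c : ℝ} {η : ℂ} (_ : ‖η‖ = 1) (_ : min a b ≤ c),
      Tendsto (fun t : Set.Ioo 0 (min a b) => (1 - (t / c : ℝ)) * η) l
        (𝓝[closedBall 0 1] η) := fun {c η} hη hc => by
    refine tendsto_nhdsWithin_iff.2 ⟨?_, Eventually.of_forall fun t =>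
      ball_subset_closedBall (hball hη hc t)⟩
    have h1 : Tendsto (fun t : ℝ => (1 - (t / c : ℝ)) * η) (𝓝 0)
        (𝓝 ((1 - ((0 : ℝ) / c : ℝ)) * η)) := by
      refine Continuous.tendsto ?_ 0
      fun_prop
    simp only [zero_div, Complex.ofReal_zero, sub_zero, one_mul] at h1
    exact (h1.mono_left nhdsWithin_le_nhds).comp hl
  have hξ' : ξ ∈ closedBall (0 : ℂ) 1 := mem_closedBall_zero_iff.2 hξ.le
  have hζ' : ζ ∈ closedBall (0 : ℂ) 1 := mem_closedBall_zero_iff.2 hζ.le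
  have hlξ := hlim hξ (min_le_left a b)
  have hlζ := hlim hζ (min_le_right a b)
  have hfζ := (hf.contDiffOn.continuousOn ζ hζ').tendsto.comp hlζ
  rw [← h] at hfζ
  have h1 := tendsto_sub_of_mem_druryArveson hψ
    (γ₁ := fun t => ⟨_, hf.mapsTo (hball hξ (min_le_left a b) t)⟩)
    (γ₂ := fun t => ⟨_, hf.mapsTo (hball hζ (min_le_right a b) t)⟩)
    ((hf.contDiffOn.continuousOn ξ hξ').tendsto.comp hlξ) hfζ (hl.eventually hK)
  have h2 := ((hu ξ hξ').tendsto.comp hlξ).sub ((hu ζ hζ').tendsto.comp hlζ)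
  refine sub_eq_zero.1 (tendsto_nhds_unique h2 (h1.congr fun t => ?_))
  exact (congrArg₂ (· - ·) (hψu ⟨_, hball hξ (min_le_left a b) t⟩)
    (hψu ⟨_, hball hζ (min_le_right a b) t⟩)).symm

/-- One inclusion gives one implication: it makes the coordinates of `g`, which are continuous up to
the circle, factor through `f`. -/
theorem apply_eq_of_pullbackAlgebra_le (hf : IsAttachedDisc V f) (hg : IsAttachedDisc W g)
    (hle : hg.pullbackAlgebra ≤ hf.pullbackAlgebra) {ξ ζ : ℂ} (hξ : ‖ξ‖ = 1) (hζ : ‖ζ‖ = 1)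
    (h : f ξ = f ζ) : g ξ = g ζ := by
  ext j
  have hmem : (fun z : Disc => g z j) ∈ hg.pullbackAlgebra :=
    (hg.mem_pullbackAlgebra _).2 ⟨_, coordinate_mem_multiplierAlgebra j, fun _ => rfl⟩
  obtain ⟨ψ, hψ, hψg⟩ := (hf.mem_pullbackAlgebra _).1 (hle hmem)
  exact hf.eq_of_mem_druryArveson (mem_druryArveson_of_mem_multiplierAlgebra hψ)
    (u := fun z => g z j)
    ((EuclideanSpace.proj (𝕜 := ℂ) j).continuous.comp_continuousOn hg.contDiffOn.continuousOn)
    hψg hξ hζ h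

end IsAttachedDisc

theorem mainTheorem1 {d e : ℕ}
    {V : Set (UnitBall d)} {W : Set (UnitBall e)}
    {f : ℂ → EuclideanSpace ℂ (Fin d)} {g : ℂ → EuclideanSpace ℂ (Fin e)}
    (hf : IsAttachedDisc V f) (hg : IsAttachedDisc W g)
    (hfg : hf.pullbackAlgebra = hg.pullbackAlgebra) :
    ∀ ξ ∈ Metric.sphere (0 : ℂ) 1, ∀ ζ ∈ Metric.sphere (0 : ℂ) 1,
      f ξ = f ζ ↔ g ξ = g ζ := by
  intro ξ hξ ζ hζ
  rw [mem_sphere_zero_iff_norm] at hξ hζ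
  exact ⟨hf.apply_eq_of_pullbackAlgebra_le hg hfg.ge hξ hζ,
    hg.apply_eq_of_pullbackAlgebra_le hf hfg.le hξ hζ⟩
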